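/- Let $(\varphi_{i,j})_{i,j\ge 1}$ be a nonnegative symmetric kernel ($\varphi_{i,j}=\varphi_{j,i}\ge 0$) that satisfies one of the following three bounds for all $i,j\ge 1$: (a) $\varphi_{i,j}\le \frac{i+j}{\min\{i,j\}}$; (b) $\varphi_{i,j}\le i+j$; (c) $\varphi_{i,j}\le (1+i+j)^{\alpha}$, where $\alpha\in[0,1]$ is a constant. Let $B^+$ be the set of real sequences $z=(z_d)_{d\ge 1}$ with $z_d\ge 0$ for all $d$ and $\|z\|:=\sum_{d\ge1} d\,|z_d|<\infty$, and let $c^0=(c^0_i)_{i\ge1}\in B^+$. For $T\in(0,\infty]$, a *solution on $[0,T)$ of the discrete Safronov–Dubovski equation with initial data $c^0$* is a function $c=(c_i)_{i\ge1}:[0,T)\to B^+$ with $c(0)=c^0$ such that 1. every $c_i$ is continuous on $[0,T)$, and $\sup_{0\le t<T}\|c(t)\|<\infty$; 2. $\int_0^t\sum_{j=1}^\infty \varphi_{i,j}c_j(h)\,dh<\infty$ for all $i\ge 1$ and $0\le t<T$; 3. for all $i\ge1$ and $0\le t<T$ the integrand below is integrable on $[0,t]$ and $$c_i(t)=c_i(0)+\int_0^t\Bigl(\delta_{i\ge2}\,c_{i-1}(h)\sum_{j=1}^{i-1}j\varphi_{i-1,j}c_j(h)-c_i(h)\sum_{j=1}^{i}j\varphi_{i,j}c_j(h)-c_i(h)\sum_{j=i}^\infty\varphi_{i,j}c_j(h)\Bigr)dh,$$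 where $\delta_{i\ge2}$ is $1$ if $i\ge2$ and $0$ otherwise. For $n\ge2$, the *non-conservative truncated system of size $n$ with initial data $c^0$* is the system of ordinary differential equations $$\frac{dc^n_i}{dt}=C^n_i(c^n)\quad(1\le i\le n,\ t\ge 0),\qquad c^n_i(0)=c^0_i\quad(1\le i\le n),$$ where $$C^n_1(z)=-\varphi_{1,1}z_1^2-z_1\sum_{j=1}^n\varphi_{1,j}z_j,\qquad C^n_n(z)=z_{n-1}\sum_{j=1}^{n-1}j\varphi_{n-1,j}z_j,$$ $$C^n_i(z)=z_{i-1}\sum_{j=1}^{i-1}j\varphi_{i-1,j}z_j-z_i\sum_{j=1}^{i}j\varphi_{i,j}z_j-z_i\sum_{j=i}^n\varphi_{i,j}z_j\quad(2\le i\le n-1).$$ Then there exists a solution of the discrete Safronov–Dubovski equation with initial data $c^0$ on $\mathbb{R}^+=[0,\infty)$. Moreover, for every $n\ge2$ the truncated system of size $n$ with initial data $c^0$ has a solution on $[0,\infty)$; and for every choice of solutions $c^n=(c^n_i)_{1\le i\le n}$ on $[0,\infty)$ of these systems ($n\ge2$) there are a strictly increasing sequence $(n_k)$ of indices and a solution $c$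 on $[0,\infty)$ of the discrete Safronov–Dubovski equation with initial data $c^0$ such that $\lim_{k\to\infty}c^{n_k}_i(t)=c_i(t)$ for all $i\ge1$ and $t\ge0$. -/

import Mathlib

open MeasureTheory Filter Topology

noncomputable section

namespace SafronovDubovski

/-!
Cluster sizes are the positive integers. Sequences `(z_d)_{d ≥ 1}` and kernels `(φ_{i,j})_{i,j ≥ 1}`
are written as functions on `ℕ`; the entries at the index `0` are never used.
-/

/-- The norm `‖z‖ = ∑_{d ≥ 1} d |z_d|` of finite mass sequences (meaningful on `B`; the term `d = 0`
is zero). -/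
def massNorm (z : ℕ → ℝ) : ℝ := ∑' d : ℕ, (d : ℝ) * |z d|

/-- The space `B` of the sequences with `∑_{d ≥ 1} d |z_d| < ∞`. -/
def B : Set (ℕ → ℝ) := {z | Summable fun d : ℕ => (d : ℝ) * |z d|}

/-- The nonnegative cone `B⁺` of `B`. -/
def BPlus : Set (ℕ → ℝ) := {z | z ∈ B ∧ ∀ d, 1 ≤ d → 0 ≤ z d}

/-- The standing assumptions on the coagulation kernel: nonnegative and symmetric. -/
def IsCoagulationKernel (φ : ℕ → ℕ → ℝ) : Prop :=
  ∀ i j, 1 ≤ i → 1 ≤ j → 0 ≤ φ i j ∧ φ i j = φ j i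

/-- The right-hand side of the `i`-th Safronov–Dubovski equation (`i ≥ 1`) at the state `z`:
`δ_{i ≥ 2} z_{i-1} ∑_{j=1}^{i-1} j φ_{i-1,j} z_j - z_i ∑_{j=1}^{i} j φ_{i,j} z_j
  - z_i ∑_{j=i}^{∞} φ_{i,j} z_j`. The index of the infinite sum is `j = i + k`. -/
def rate (φ : ℕ → ℕ → ℝ) (z : ℕ → ℝ) (i : ℕ) : ℝ :=
  (if 2 ≤ i then z (i - 1) * ∑ j ∈ Finset.Icc 1 (i - 1), (j : ℝ) * φ (i - 1) j * z j else 0)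
    - z i * ∑ j ∈ Finset.Icc 1 i, (j : ℝ) * φ i j * z j
    - z i * ∑' k : ℕ, φ i (i + k) * z (i + k)

/-- The time interval `[0, T)` for `T ∈ (0, ∞]`. -/
def timeInterval (T : EReal) : Set ℝ := {t | 0 ≤ t ∧ (t : EReal) < T}

/-- `c` is a solution on `[0, T)` of the Safronov–Dubovski equation with initial data `c₀`;
`c t i` is the concentration `c_i(t)`. -/
structure IsSolution (φ : ℕ → ℕ → ℝ) (c₀ : ℕ → ℝ) (T : EReal) (c : ℝ → ℕ → ℝ) : Prop where
  mem_BPlus : ∀ t ∈ timeInterval T, c t ∈ BPlus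
  initial : ∀ i, 1 ≤ i → c 0 i = c₀ i
  continuousOn : ∀ i, 1 ≤ i → ContinuousOn (fun t => c t i) (timeInterval T)
  bounded : BddAbove ((fun t => massNorm (c t)) '' timeInterval T)
  /-- `∫₀ᵗ ∑_{j ≥ 1} φ_{i,j} c_j(h) dh < ∞`, for the nonnegative integrand with values in
  `[0, ∞]`. -/
  lintegral_lt_top : ∀ i, 1 ≤ i → ∀ t ∈ timeInterval T,
    ∫⁻ h in Set.Icc 0 t, ∑' j : ℕ, ENNReal.ofReal (φ i (j + 1) * c h (j + 1)) < ⊤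
  integrable : ∀ i, 1 ≤ i → ∀ t ∈ timeInterval T,
    IntervalIntegrable (fun h => rate φ (c h) i) volume 0 t
  integral_eq : ∀ i, 1 ≤ i → ∀ t ∈ timeInterval T,
    c t i = c 0 i + ∫ h in (0 : ℝ)..t, rate φ (c h) i

/-- The right-hand side `C^n_i(z)`, `1 ≤ i ≤ n`, of the non-conservative truncated system of size
`n ≥ 2`. -/
def truncRate (φ : ℕ → ℕ → ℝ) (n : ℕ) (z : ℕ → ℝ) (i : ℕ) : ℝ :=
  if i = 1 then
    - φ 1 1 * z 1 ^ 2 - z 1 * ∑ j ∈ Finset.Icc 1 n, φ 1 j * z j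
  else if i = n then
    z (n - 1) * ∑ j ∈ Finset.Icc 1 (n - 1), (j : ℝ) * φ (n - 1) j * z j
  else
    z (i - 1) * ∑ j ∈ Finset.Icc 1 (i - 1), (j : ℝ) * φ (i - 1) j * z j
      - z i * ∑ j ∈ Finset.Icc 1 i, (j : ℝ) * φ i j * z j
      - z i * ∑ j ∈ Finset.Icc i n, φ i j * z j

/-- `u` solves, on `[0, ∞)`, the non-conservative truncated system of size `n` with the first `n`
entries of `c₀` as initial data. Only the entries `u t i` with `1 ≤ i ≤ n` are used. -/
structure IsTruncatedSolution (φ : ℕ → ℕ → ℝ) (c₀ : ℕ → ℝ) (n : ℕ) (u : ℝ → ℕ → ℝ) : Prop where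
  initial : ∀ i ∈ Finset.Icc 1 n, u 0 i = c₀ i
  hasDeriv : ∀ i ∈ Finset.Icc 1 n, ∀ t : ℝ, 0 ≤ t →
    HasDerivWithinAt (fun s => u s i) (truncRate φ n (u t) i) (Set.Ici 0) t

/-- The three growth bounds on the kernel, one of which is required. -/
def KernelBound (φ : ℕ → ℕ → ℝ) : Prop :=
  (∀ i j : ℕ, 1 ≤ i → 1 ≤ j → φ i j ≤ ((i : ℝ) + j) / min (i : ℝ) j) ∨
  (∀ i j : ℕ, 1 ≤ i → 1 ≤ j → φ i j ≤ (i : ℝ) + j) ∨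
  (∃ α : ℝ, 0 ≤ α ∧ α ≤ 1 ∧ ∀ i j : ℕ, 1 ≤ i → 1 ≤ j → φ i j ≤ (1 + (i : ℝ) + j) ^ α)

end SafronovDubovski

end

/-!
All three growth bounds imply `φ i j ≤ 2 (i + j)`, and this is all that is used of them.

Solutions of the truncated systems stay nonnegative, because each right-hand side has the form
`g - z_i b` with `g ≥ 0` built from smaller indices. By symmetry of `φ` their mass does not increase
(`sum_mul_truncRate_nonpos`), so that `M = ‖c₀‖` bounds it. In particular every solution remains in
the box `[0, M]^n`, where the vector field is bounded and Lipschitz, and this gives global existence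
(`exists_isTruncatedSolution`). Moreover all rates are bounded by `12 M²` (`abs_rate_le`), uniformly
in the size of the system, and a diagonal argument extracts a subsequence that converges pointwise
(`exists_subseq_tendsto`).

Since `φ i j` may grow linearly in `j`, convergence of `∑_j φ i j c_j` requires that no mass escapes
to infinity. This is measured by the tail moments `S_b = ∑_i max (i - b) 0 c_i`. Sizes increase by
one at each growth event, so only sizes `i ≥ 2 b` contribute to the growth of `S_{2b}`, and for
these `i ≤ 2 (i - b)`; this yields the closed hierarchy `S_{2b}' ≤ 8 M S_b`
(`sum_tsub_mul_truncRate_le`). Let `A_k` be a sequence with `A_0 = M`, `A_k ≥ S_{2^k}(0)` and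
`A_k ≥ A_{k-1} / 2`; then induction on `k` gives `S_{2^k}(t) ≤ A_k exp (16 M t)`
(`IsTruncatedSolution.tail_le`), and the least such sequence tends to zero because `c₀` has finite
mass (`tendsto_tailBound`). The tails are thus small uniformly in the size of the truncation and
locally uniformly in time, the rates converge pointwise (`tendsto_rate`), and dominated convergence
passes to the limit in the integral equations (`isSolution_of_tendsto`).
-/

namespace SafronovDubovski

variable {φ : ℕ → ℕ → ℝ} {c₀ z : ℕ → ℝ} {n i : ℕ} {M : ℝ}

/-! ### Fluxes and the algebra of the truncated system -/

/-- The flux `z_i ∑_{j=1}^{i} j φ_{i,j} z_j` from clusters of size `i` to clusters of size `i + 1`. -/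
noncomputable def growthFlux (φ : ℕ → ℕ → ℝ) (z : ℕ → ℝ) (i : ℕ) : ℝ :=
  z i * ∑ j ∈ Finset.Icc 1 i, (j : ℝ) * φ i j * z j

/-- The rate `z_i ∑_{j=i}^{n} φ_{i,j} z_j` at which clusters of size `i` are crushed into monomers
by clusters of sizes between `i` and `n`. -/
noncomputable def truncLoss (φ : ℕ → ℕ → ℝ) (n : ℕ) (z : ℕ → ℝ) (i : ℕ) : ℝ :=
  z i * ∑ j ∈ Finset.Icc i n, φ i j * z j

theorem truncRate_eq (hn : 2 ≤ n) (hi : 1 ≤ i) :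
    truncRate φ n z i = (if 2 ≤ i then growthFlux φ z (i - 1) else 0)
      - (if i = n then 0 else growthFlux φ z i + truncLoss φ n z i) := by
  unfold truncRate growthFlux truncLoss
  by_cases h1 : i = 1
  · subst h1
    have : ¬ (1 = n) := by omega
    simp [this]
    ring
  · have h2 : 2 ≤ i := by omega
    by_cases hin : i = n
    · have h3 : ¬ n = 1 := by omega
      simp [hin, hn, h3]
    · simp [h1, h2, hin]
      ring

/-- Weak form of the truncated system: summation by parts against a test sequence `g`. -/
theorem sum_mul_truncRate (g : ℕ → ℝ) (m : ℕ) (hm : 1 ≤ m) :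
    ∑ i ∈ Finset.Icc 1 (m + 1), g i * truncRate φ (m + 1) z i =
      ∑ i ∈ Finset.Icc 1 m,
        ((g (i + 1) - g i) * growthFlux φ z i - g i * truncLoss φ (m + 1) z i) := by
  have key : ∀ (f : ℕ → ℝ) (m : ℕ), ∑ i ∈ Finset.Icc 1 m, f i = ∑ k ∈ Finset.range m, f (k + 1) := by
    intro f m
    rw [Finset.range_eq_Ico, Finset.sum_Ico_add' f 0 m 1]
    rfl
  rw [key, key]
  have : ∀ k ∈ Finset.range (m + 1), g (k + 1) * truncRate φ (m + 1) z (k + 1) =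
      (if 1 ≤ k then g (k + 1) * growthFlux φ z k else 0) -
      (if k = m then 0 else
        g (k + 1) * (growthFlux φ z (k + 1) + truncLoss φ (m + 1) z (k + 1))) := by
    intro k _
    rw [truncRate_eq (by omega) (by omega)]
    by_cases h1 : 1 ≤ k <;> by_cases h2 : k = m <;> simp [h1, h2] <;> ring
  rw [Finset.sum_congr rfl this, Finset.sum_sub_distrib, Finset.sum_range_succ' _ m,
    Finset.sum_range_succ _ m]
  have h01 : ¬ 1 ≤ 0 := by omega
  simp only [le_add_iff_nonneg_left, zero_le, if_true, h01, if_false, add_zero]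
  rw [← Finset.sum_sub_distrib]
  refine Finset.sum_congr rfl fun k hk => ?_
  have : k ≠ m := (Finset.mem_range.1 hk).ne
  simp only [this, if_false]
  ring

theorem growthFlux_nonneg (hφ : IsCoagulationKernel φ) (hi : 1 ≤ i)
    (hz : ∀ j ∈ Finset.Icc 1 i, 0 ≤ z j) : 0 ≤ growthFlux φ z i := by
  refine mul_nonneg (hz i (by simp [hi])) (Finset.sum_nonneg fun j hj => ?_)
  have := hz j hj
  have := (hφ i j hi (Finset.mem_Icc.1 hj).1).1
  positivity

theorem truncLoss_nonneg (hφ : IsCoagulationKernel φ) (hi : 1 ≤ i) (hin : i ≤ n)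
    (hz : ∀ j ∈ Finset.Icc 1 n, 0 ≤ z j) : 0 ≤ truncLoss φ n z i := by
  refine mul_nonneg (hz i (by simp [hi, hin])) (Finset.sum_nonneg fun j hj => ?_)
  have hj' := Finset.mem_Icc.1 hj
  exact mul_nonneg (hφ i j hi (by omega)).1 (hz j (Finset.mem_Icc.2 ⟨by omega, hj'.2⟩))

/-- The mass of the truncated system does not increase: by symmetry of `φ`, the mass gained by
growth is at most the mass lost by crushing. -/
theorem sum_mul_truncRate_nonpos (hφ : IsCoagulationKernel φ) (hn : 2 ≤ n)
    (hz : ∀ j ∈ Finset.Icc 1 n, 0 ≤ z j) :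
    ∑ i ∈ Finset.Icc 1 n, (i : ℝ) * truncRate φ n z i ≤ 0 := by
  obtain ⟨m, rfl⟩ : ∃ m, n = m + 1 := ⟨n - 1, by omega⟩
  rw [sum_mul_truncRate (fun i => (i : ℝ)) m (by omega), Finset.sum_sub_distrib, sub_nonpos]
  have h1 : ∑ i ∈ Finset.Icc 1 m, (((i + 1 : ℕ) : ℝ) - (i : ℝ)) * growthFlux φ z i =
      ∑ i ∈ Finset.Icc 1 m, ∑ j ∈ Finset.Icc i m, (i : ℝ) * z i * (φ i j * z j) := by
    simp only [growthFlux, Nat.cast_add, Nat.cast_one, add_sub_cancel_left, one_mul, Finset.mul_sum]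
    rw [Finset.sum_comm' (s' := fun j => Finset.Icc j m) (t' := Finset.Icc 1 m)
      (by intro x y; simp only [Finset.mem_Icc]; omega)]
    refine Finset.sum_congr rfl fun j hj => Finset.sum_congr rfl fun i hi => ?_
    simp only [Finset.mem_Icc] at hi hj
    rw [(hφ i j (by omega) hj.1).2]
    ring
  rw [h1]
  refine Finset.sum_le_sum fun i hi => ?_
  simp only [Finset.mem_Icc] at hi
  rw [truncLoss, ← mul_assoc, Finset.mul_sum]
  refine Finset.sum_le_sum_of_subset_of_nonneg (Finset.Icc_subset_Icc_right (by omega)) ?_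
  intro j hj _
  simp only [Finset.mem_Icc] at hj
  have h1 := hz i (Finset.mem_Icc.2 ⟨hi.1, by omega⟩)
  have h2 := hz j (Finset.mem_Icc.2 ⟨by omega, hj.2⟩)
  have h3 := (hφ i j (by omega) (by omega)).1
  positivity

/-- Each of the three growth conditions is, up to a constant, the linear one. -/
theorem KernelBound.le_two_mul (h : KernelBound φ) {i j : ℕ} (hi : 1 ≤ i) (hj : 1 ≤ j) :
    φ i j ≤ 2 * ((i : ℝ) + j) := by
  have hi' : (1 : ℝ) ≤ i := by exact_mod_cast hi
  have hj' : (1 : ℝ) ≤ j := by exact_mod_cast hj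
  rcases h with h | h | ⟨α, h0, h1, h⟩
  · refine (h i j hi hj).trans ?_
    have : ((i : ℝ) + j) / min (i : ℝ) j ≤ (i : ℝ) + j :=
      div_le_self (by linarith) (le_min hi' hj')
    linarith
  · linarith [h i j hi hj]
  · refine (h i j hi hj).trans ?_
    have : (1 + (i : ℝ) + j) ^ α ≤ (1 + (i : ℝ) + j) ^ (1 : ℝ) :=
      Real.rpow_le_rpow_of_exponent_le (by linarith) h1
    rw [Real.rpow_one] at this
    linarith

theorem growthFlux_le (hb : KernelBound φ) (hi : 1 ≤ i)
    (hz : ∀ j ∈ Finset.Icc 1 i, 0 ≤ z j) (hM : ∑ j ∈ Finset.Icc 1 i, (j : ℝ) * z j ≤ M) :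
    growthFlux φ z i ≤ 4 * M * (i * z i) := by
  have h0 := hz i (by simp [hi])
  have : ∑ j ∈ Finset.Icc 1 i, (j : ℝ) * φ i j * z j ≤ 4 * i * M := by
    refine le_trans ?_ (mul_le_mul_of_nonneg_left hM (by positivity))
    rw [Finset.mul_sum]
    refine Finset.sum_le_sum fun j hj => ?_
    have h1 := hz j hj
    simp only [Finset.mem_Icc] at hj
    have h2 := hb.le_two_mul hi hj.1
    have h3 : (j : ℝ) ≤ i := by exact_mod_cast hj.2
    have h4 : φ i j ≤ 4 * i := by linarith
    calc (j : ℝ) * φ i j * z j = φ i j * (j * z j) := by ring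
      _ ≤ 4 * i * (j * z j) := mul_le_mul_of_nonneg_right h4 (by positivity)
  calc growthFlux φ z i ≤ z i * (4 * i * M) := mul_le_mul_of_nonneg_left this h0
    _ = _ := by ring

/-- The tail moment at `2 b` grows at a rate controlled by the tail moment at `b` (truncated
subtraction: `i - b` is `max (i - b) 0`). -/
theorem sum_tsub_mul_truncRate_le (hφ : IsCoagulationKernel φ) (hb : KernelBound φ) (hn : 2 ≤ n)
    (hz : ∀ j ∈ Finset.Icc 1 n, 0 ≤ z j) (hM : ∑ j ∈ Finset.Icc 1 n, (j : ℝ) * z j ≤ M) (b : ℕ) :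
    ∑ i ∈ Finset.Icc 1 n, ((i - 2 * b : ℕ) : ℝ) * truncRate φ n z i ≤
      8 * M * ∑ i ∈ Finset.Icc 1 n, ((i - b : ℕ) : ℝ) * z i := by
  obtain ⟨m, rfl⟩ : ∃ m, n = m + 1 := ⟨n - 1, by omega⟩
  have hM0 : 0 ≤ M := le_trans (Finset.sum_nonneg fun j hj => by have := hz j hj; positivity) hM
  rw [sum_mul_truncRate (fun i => ((i - 2 * b : ℕ) : ℝ)) m (by omega), Finset.mul_sum]
  refine le_trans (Finset.sum_le_sum (g := fun i => 8 * M * (((i - b : ℕ) : ℝ) * z i)) ?_)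
    (Finset.sum_le_sum_of_subset_of_nonneg (Finset.Icc_subset_Icc_right (by omega)) ?_)
  · intro i hi
    simp only [Finset.mem_Icc] at hi
    have hzi := hz i (Finset.mem_Icc.2 ⟨hi.1, by omega⟩)
    have hL := truncLoss_nonneg (i := i) hφ hi.1 (by omega) hz
    have hsub : Finset.Icc 1 i ⊆ Finset.Icc 1 (m + 1) := Finset.Icc_subset_Icc_right (by omega)
    have hG := growthFlux_le (i := i) (M := M) hb hi.1 (fun j hj => hz j (hsub hj))
      (le_trans (Finset.sum_le_sum_of_subset_of_nonneg hsub
        fun j hj _ => by have := hz j hj; positivity) hM)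
    have hg : (((i + 1 - 2 * b : ℕ) : ℝ) - ((i - 2 * b : ℕ) : ℝ)) * i ≤ 2 * ((i - b : ℕ) : ℝ) := by
      rcases Nat.lt_or_ge i (2 * b) with h | h
      · have h1 : i + 1 - 2 * b = 0 := by omega
        have h2 : i - 2 * b = 0 := by omega
        rw [h1, h2]
        simp
      · have h1 : i + 1 - 2 * b = (i - 2 * b) + 1 := by omega
        have h2 : i ≤ 2 * (i - b) := by omega
        have h2' : (i : ℝ) ≤ 2 * ((i - b : ℕ) : ℝ) := by exact_mod_cast h2
        rw [h1]
        push_cast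
        linarith
    have hg0 : 0 ≤ ((i + 1 - 2 * b : ℕ) : ℝ) - ((i - 2 * b : ℕ) : ℝ) := by
      have : i - 2 * b ≤ i + 1 - 2 * b := by omega
      rw [sub_nonneg]
      exact_mod_cast this
    have hL' : 0 ≤ ((i - 2 * b : ℕ) : ℝ) * truncLoss φ (m + 1) z i := by positivity
    calc _ ≤ (((i + 1 - 2 * b : ℕ) : ℝ) - ((i - 2 * b : ℕ) : ℝ)) * (4 * M * (i * z i)) := by
          linarith [mul_le_mul_of_nonneg_left hG hg0]
      _ = ((((i + 1 - 2 * b : ℕ) : ℝ) - ((i - 2 * b : ℕ) : ℝ)) * i) * (4 * M * z i) := by ring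
      _ ≤ (2 * ((i - b : ℕ) : ℝ)) * (4 * M * z i) :=
          mul_le_mul_of_nonneg_right hg (by positivity)
      _ = _ := by ring
  · intro j hj _
    have := hz j hj
    positivity

/-! ### Scalar differential inequalities -/

theorem le_of_hasDerivWithinAt_le {f f' B B' : ℝ → ℝ}
    (hf : ∀ t, 0 ≤ t → HasDerivWithinAt f (f' t) (Set.Ici 0) t)
    (hB : ∀ t, 0 ≤ t → HasDerivWithinAt B (B' t) (Set.Ici 0) t)
    (h0 : f 0 ≤ B 0) (hle : ∀ t, 0 ≤ t → f' t ≤ B' t) {t : ℝ} (ht : 0 ≤ t) : f t ≤ B t := by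
  refine image_le_of_deriv_right_le_deriv_boundary (a := 0) (b := t) (f' := f') (B' := B')
    (fun s hs => ((hf s hs.1).continuousWithinAt).mono Set.Icc_subset_Ici_self)
    (fun s hs => (hf s hs.1).mono (Set.Ici_subset_Ici.2 hs.1)) h0
    (fun s hs => ((hB s hs.1).continuousWithinAt).mono Set.Icc_subset_Ici_self)
    (fun s hs => (hB s hs.1).mono (Set.Ici_subset_Ici.2 hs.1))
    (fun s hs => hle s hs.1) ⟨ht, le_rfl⟩

/-- A function that starts nonnegative and is nondecreasing wherever it is negative stays
nonnegative. -/
theorem nonneg_of_deriv_nonneg_of_neg {f f' : ℝ → ℝ} {T : ℝ}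
    (hf : ∀ t, 0 ≤ t → HasDerivWithinAt f (f' t) (Set.Ici 0) t)
    (h0 : 0 ≤ f 0) (hneg : ∀ t ∈ Set.Icc 0 T, f t < 0 → 0 ≤ f' t) :
    ∀ t ∈ Set.Icc 0 T, 0 ≤ f t := by
  intro t₁ ht₁
  by_contra! hlt
  have hcont : ContinuousOn f (Set.Icc 0 t₁) := fun s hs =>
    ((hf s hs.1).continuousWithinAt).mono Set.Icc_subset_Ici_self
  -- the last time before `t₁` at which `f` is nonnegative
  obtain ⟨t₀, ⟨ht₀, hft₀⟩, hmax⟩ : ∃ t₀, IsGreatest (Set.Icc 0 t₁ ∩ f ⁻¹' Set.Ici 0) t₀ :=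
    (isCompact_Icc.of_isClosed_subset (hcont.preimage_isClosed_of_isClosed isClosed_Icc isClosed_Ici)
      Set.inter_subset_left).exists_isGreatest ⟨0, ⟨le_rfl, ht₁.1⟩, h0⟩
  have hmono : MonotoneOn f (Set.Icc t₀ t₁) := by
    refine monotoneOn_of_hasDerivWithinAt_nonneg (f' := f') (convex_Icc _ _)
      (hcont.mono (Set.Icc_subset_Icc_left ht₀.1)) ?_ ?_
    · intro s hs
      rw [interior_Icc] at hs ⊢
      exact (hf s (ht₀.1.trans hs.1.le)).mono fun x hx => ht₀.1.trans hx.1.le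
    · intro s hs
      rw [interior_Icc] at hs
      refine hneg s ⟨ht₀.1.trans hs.1.le, hs.2.le.trans ht₁.2⟩ ?_
      by_contra! h
      exact absurd (hmax ⟨⟨ht₀.1.trans hs.1.le, hs.2.le⟩, h⟩) (not_le.2 hs.1)
  have := hmono ⟨le_rfl, ht₀.2⟩ ⟨ht₀.2, le_rfl⟩ ht₀.2
  have h1 : 0 ≤ f t₀ := hft₀
  linarith

/-- Nonnegativity for `f' = g - f b` with `g ≥ 0`: with `|b| ≤ K` on `[0, T]`, the function
`f exp (-K t)` is nondecreasing wherever it is negative. -/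
theorem nonneg_of_hasDeriv_linear {f g b : ℝ → ℝ}
    (hf : ∀ t, 0 ≤ t → HasDerivWithinAt f (g t - f t * b t) (Set.Ici 0) t)
    (h0 : 0 ≤ f 0) (hg : ∀ t, 0 ≤ t → 0 ≤ g t) (hb : ContinuousOn b (Set.Ici 0)) {T : ℝ}
    (hT : 0 ≤ T) : 0 ≤ f T := by
  obtain ⟨K, hK⟩ := (isCompact_Icc (a := (0 : ℝ)) (b := T)).exists_bound_of_continuousOn
    (hb.mono Set.Icc_subset_Ici_self)
  have hd : ∀ t, 0 ≤ t → HasDerivWithinAt (fun t => f t * Real.exp (-K * t))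
      ((g t - f t * b t) * Real.exp (-K * t) + f t * (Real.exp (-K * t) * (-K * 1)))
      (Set.Ici 0) t := fun t ht =>
    (hf t ht).mul (((hasDerivAt_id t).const_mul (-K)).exp.hasDerivWithinAt)
  have := nonneg_of_deriv_nonneg_of_neg (T := T) hd (by simpa using h0) ?_ T ⟨hT, le_rfl⟩
  · exact nonneg_of_mul_nonneg_left this (Real.exp_pos _)
  · intro t ht hneg
    have hft : f t < 0 := by
      by_contra! h
      exact absurd hneg (not_lt.2 (mul_nonneg h (Real.exp_pos _).le))
    have hbt := hK t ht
    rw [Real.norm_eq_abs, abs_le] at hbt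
    have h1 := hg t ht.1
    have h2 : 0 ≤ -f t * (b t + K) := mul_nonneg (by linarith) (by linarith)
    have h3 : 0 ≤ (g t + -f t * (b t + K)) * Real.exp (-K * t) :=
      mul_nonneg (by linarith) (Real.exp_pos _).le
    linarith

/-! ### A priori bounds for the truncated system -/

theorem sum_le_massNorm (hc₀ : c₀ ∈ BPlus) (n : ℕ) :
    ∑ i ∈ Finset.Icc 1 n, (i : ℝ) * c₀ i ≤ massNorm c₀ := by
  refine le_trans (Finset.sum_le_sum fun i _ => ?_)
    (hc₀.1.sum_le_tsum _ fun i _ => by positivity)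
  exact mul_le_mul_of_nonneg_left (le_abs_self _) (Nat.cast_nonneg _)

theorem massNorm_nonneg (z : ℕ → ℝ) : 0 ≤ massNorm z :=
  tsum_nonneg fun _ => by positivity

namespace IsTruncatedSolution

variable {u : ℝ → ℕ → ℝ}

theorem continuousOn (hu : IsTruncatedSolution φ c₀ n u) (hi : i ∈ Finset.Icc 1 n) :
    ContinuousOn (fun t => u t i) (Set.Ici 0) :=
  fun t ht => (hu.hasDeriv i hi t ht).continuousWithinAt

/-- Nonnegativity by induction on the size: the gain term of the `i`-th equation involves only
entries of index less than `i`, and the loss terms are multiples of `u_i`. -/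
theorem nonneg (hu : IsTruncatedSolution φ c₀ n u) (hφ : IsCoagulationKernel φ)
    (hc₀ : c₀ ∈ BPlus) (hn : 2 ≤ n) :
    ∀ i ∈ Finset.Icc 1 n, ∀ t, 0 ≤ t → 0 ≤ u t i := by
  intro i
  induction i using Nat.strong_induction_on with
  | _ i ih =>
    intro hi t ht
    have hi' := Finset.mem_Icc.1 hi
    refine nonneg_of_hasDeriv_linear (f := fun t => u t i)
      (g := fun t => if 2 ≤ i then growthFlux φ (u t) (i - 1) else 0)
      (b := fun t => if i = n then 0 else ∑ j ∈ Finset.Icc 1 i, (j : ℝ) * φ i j * u t j +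
        ∑ j ∈ Finset.Icc i n, φ i j * u t j) ?_ ?_ ?_ ?_ ht
    · intro s hs
      convert hu.hasDeriv i hi s hs using 1
      rw [truncRate_eq hn hi'.1]
      congr 1
      by_cases h : i = n
      · simp [h]
      · simp only [h, if_false, growthFlux, truncLoss]
        ring
    · rw [hu.initial i hi]
      exact hc₀.2 i hi'.1
    · intro s hs
      split_ifs with h
      · refine growthFlux_nonneg hφ (by omega) fun j hj => ?_
        simp only [Finset.mem_Icc] at hj
        exact ih j (by omega) (Finset.mem_Icc.2 (by omega)) s hs
      · exact le_rfl
    · split_ifs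
      · exact continuousOn_const
      · refine (continuousOn_finsetSum _ fun j hj => ?_).add
          (continuousOn_finsetSum _ fun j hj => ?_)
        all_goals
          simp only [Finset.mem_Icc] at hj
          exact continuousOn_const.mul (hu.continuousOn (Finset.mem_Icc.2 (by omega)))

theorem hasDeriv_sum (hu : IsTruncatedSolution φ c₀ n u) (g : ℕ → ℝ) {t : ℝ} (ht : 0 ≤ t) :
    HasDerivWithinAt (fun s => ∑ i ∈ Finset.Icc 1 n, g i * u s i)
      (∑ i ∈ Finset.Icc 1 n, g i * truncRate φ n (u t) i) (Set.Ici 0) t :=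
  HasDerivWithinAt.fun_sum fun i hi => (hu.hasDeriv i hi t ht).const_mul _

theorem sum_initial (hu : IsTruncatedSolution φ c₀ n u) (g : ℕ → ℝ) :
    ∑ i ∈ Finset.Icc 1 n, g i * u 0 i = ∑ i ∈ Finset.Icc 1 n, g i * c₀ i :=
  Finset.sum_congr rfl fun i hi => by rw [hu.initial i hi]

theorem mass_le (hu : IsTruncatedSolution φ c₀ n u) (hφ : IsCoagulationKernel φ)
    (hc₀ : c₀ ∈ BPlus) (hn : 2 ≤ n) {t : ℝ} (ht : 0 ≤ t) :
    ∑ i ∈ Finset.Icc 1 n, (i : ℝ) * u t i ≤ massNorm c₀ := by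
  refine le_of_hasDerivWithinAt_le (B := fun _ => massNorm c₀) (B' := fun _ => 0)
    (fun s hs => hu.hasDeriv_sum (fun i => (i : ℝ)) hs) (fun s _ => hasDerivWithinAt_const _ _ _) ?_
    (fun s hs => sum_mul_truncRate_nonpos hφ hn fun j hj => hu.nonneg hφ hc₀ hn j hj s hs) ht
  rw [hu.sum_initial fun i => (i : ℝ)]
  exact sum_le_massNorm hc₀ n

end IsTruncatedSolution

/-! ### Uniform smallness of the tails of the mass -/

/-- The tail moment `∑_i max (i - b) 0 c_i` of a sequence of finite mass. -/
noncomputable def tailMoment (z : ℕ → ℝ) (b : ℕ) : ℝ := ∑' i : ℕ, ((i - b : ℕ) : ℝ) * |z i|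

theorem summable_tailMoment (hz : z ∈ B) (b : ℕ) :
    Summable fun i : ℕ => ((i - b : ℕ) : ℝ) * |z i| :=
  Summable.of_nonneg_of_le (fun _ => by positivity)
    (fun i => mul_le_mul_of_nonneg_right (by exact_mod_cast Nat.sub_le i b) (abs_nonneg _)) hz

theorem tendsto_tailMoment (hz : z ∈ B) : Tendsto (tailMoment z) atTop (𝓝 0) := by
  have := tendsto_tsum_of_dominated_convergence (𝓕 := atTop)
    (f := fun b i : ℕ => ((i - b : ℕ) : ℝ) * |z i|) (g := fun _ => 0) hz ?_ ?_
  · rw [tsum_zero] at this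
    exact this
  · intro i
    refine tendsto_const_nhds.congr' ?_
    filter_upwards [eventually_ge_atTop i] with b hb
    simp [Nat.sub_eq_zero_of_le hb]
  · refine Eventually.of_forall fun b i => ?_
    rw [Real.norm_of_nonneg (by positivity)]
    exact mul_le_mul_of_nonneg_right (by exact_mod_cast Nat.sub_le i b) (abs_nonneg _)

/-- Bounds for the tail moments at `2 ^ k`: the least sequence dominating the initial tail moments
that decreases at most by the factor `2`. -/
noncomputable def tailBound (z : ℕ → ℝ) : ℕ → ℝ
  | 0 => massNorm z
  | k + 1 => max (tailMoment z (2 ^ (k + 1))) (tailBound z k / 2)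

theorem tailBound_nonneg (z : ℕ → ℝ) : ∀ k, 0 ≤ tailBound z k
  | 0 => massNorm_nonneg z
  | _ + 1 => le_max_of_le_left (tsum_nonneg fun _ => by positivity)

theorem tendsto_tailBound (hz : z ∈ B) : Tendsto (tailBound z) atTop (𝓝 0) := by
  rw [Metric.tendsto_atTop]
  intro ε hε
  have h1 : Tendsto (fun k : ℕ => tailMoment z (2 ^ (k + 1))) atTop (𝓝 0) :=
    (tendsto_tailMoment hz).comp
      ((tendsto_pow_atTop_atTop_of_one_lt one_lt_two).comp (tendsto_add_atTop_nat 1))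
  obtain ⟨N, hN⟩ := eventually_atTop.1 (h1.eventually (gt_mem_nhds (half_pos hε)))
  have h2 : ∀ k, tailBound z (N + k) ≤ max (ε / 2) (tailBound z N / 2 ^ k) := by
    intro k
    induction k with
    | zero => simp
    | succ k ih =>
      rw [← Nat.add_assoc, tailBound]
      refine max_le (le_max_of_le_left (hN _ (by omega)).le) ?_
      rcases le_max_iff.1 ih with h | h
      · exact le_max_of_le_left (by linarith)
      · refine le_max_of_le_right ?_
        rw [pow_succ, ← div_div]
        linarith
  have h3 : Tendsto (fun k : ℕ => tailBound z N / 2 ^ k) atTop (𝓝 0) :=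
    tendsto_const_nhds.div_atTop (tendsto_pow_atTop_atTop_of_one_lt one_lt_two)
  obtain ⟨K, hK⟩ := eventually_atTop.1 (h3.eventually (gt_mem_nhds hε))
  refine ⟨N + K, fun k hk => ?_⟩
  rw [Real.dist_eq, sub_zero, abs_of_nonneg (tailBound_nonneg z k)]
  obtain ⟨l, rfl⟩ : ∃ l, k = N + l := ⟨k - N, by omega⟩
  exact (h2 l).trans_lt (max_lt (by linarith) (hK l (by omega)))

namespace IsTruncatedSolution

variable {u : ℝ → ℕ → ℝ}

/-- With `S_k = ∑_i max (i - 2 ^ k) 0 u_i`, the inequality `S_{k+1}' ≤ 8 M S_k` propagates the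
bound `A_k exp (16 M t)` from `k` to `k + 1`, since `A_k ≤ 2 A_{k+1}`. -/
theorem tail_le (hu : IsTruncatedSolution φ c₀ n u) (hφ : IsCoagulationKernel φ)
    (hb : KernelBound φ) (hc₀ : c₀ ∈ BPlus) (hn : 2 ≤ n) (k : ℕ) :
    ∀ t, 0 ≤ t → ∑ i ∈ Finset.Icc 1 n, ((i - 2 ^ k : ℕ) : ℝ) * u t i ≤
      tailBound c₀ k * Real.exp (16 * massNorm c₀ * t) := by
  have hM := massNorm_nonneg c₀
  induction k with
  | zero =>
    intro t ht
    have h1 : ∑ i ∈ Finset.Icc 1 n, ((i - 2 ^ 0 : ℕ) : ℝ) * u t i ≤ massNorm c₀ :=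
      (Finset.sum_le_sum fun i hi => mul_le_mul_of_nonneg_right
        (by exact_mod_cast Nat.sub_le i _) (hu.nonneg hφ hc₀ hn i hi t ht)).trans
          (hu.mass_le hφ hc₀ hn ht)
    exact h1.trans (le_mul_of_one_le_right hM (Real.one_le_exp (by positivity)))
  | succ k ih =>
    intro t ht
    have hB : ∀ s : ℝ, 0 ≤ s → HasDerivWithinAt
        (fun s => tailBound c₀ (k + 1) * Real.exp (16 * massNorm c₀ * s))
        (tailBound c₀ (k + 1) * (Real.exp (16 * massNorm c₀ * s) * (16 * massNorm c₀ * 1)))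
        (Set.Ici 0) s := fun s _ =>
      (((hasDerivAt_id s).const_mul (16 * massNorm c₀)).exp.const_mul _).hasDerivWithinAt
    refine le_of_hasDerivWithinAt_le
      (fun s hs => hu.hasDeriv_sum (fun i => ((i - 2 ^ (k + 1) : ℕ) : ℝ)) hs) hB ?_ ?_ ht
    · rw [hu.sum_initial fun i => ((i - 2 ^ (k + 1) : ℕ) : ℝ)]
      simp only [mul_zero, Real.exp_zero, mul_one]
      refine le_max_of_le_left (le_trans (Finset.sum_le_sum fun i _ => ?_)
        ((summable_tailMoment hc₀.1 _).sum_le_tsum _ fun i _ => by positivity))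
      exact mul_le_mul_of_nonneg_left (le_abs_self _) (Nat.cast_nonneg _)
    · intro s hs
      have h1 := sum_tsub_mul_truncRate_le hφ hb hn (z := u s)
        (fun j hj => hu.nonneg hφ hc₀ hn j hj s hs) (hu.mass_le hφ hc₀ hn hs) (2 ^ k)
      rw [← pow_succ'] at h1
      refine h1.trans ?_
      have h2 : tailBound c₀ k / 2 ≤ tailBound c₀ (k + 1) := le_max_right _ _
      have he := Real.exp_pos (16 * massNorm c₀ * s)
      calc 8 * massNorm c₀ * ∑ i ∈ Finset.Icc 1 n, ((i - 2 ^ k : ℕ) : ℝ) * u s i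
          ≤ 8 * massNorm c₀ * (tailBound c₀ k * Real.exp (16 * massNorm c₀ * s)) :=
            mul_le_mul_of_nonneg_left (ih s hs) (by positivity)
        _ = tailBound c₀ k / 2 * (Real.exp (16 * massNorm c₀ * s) * (16 * massNorm c₀ * 1)) := by
            ring
        _ ≤ _ := mul_le_mul_of_nonneg_right h2 (by positivity)

end IsTruncatedSolution

/-- The tails of the mass are small, uniformly in the size of the truncation and in the chosen
solution, and locally uniformly in time. -/
theorem exists_forall_tail_le (hφ : IsCoagulationKernel φ) (hb : KernelBound φ)
    (hc₀ : c₀ ∈ BPlus) (T : ℝ) {ε : ℝ} (hε : 0 < ε) :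
    ∃ J : ℕ, ∀ n u, 2 ≤ n → IsTruncatedSolution φ c₀ n u → ∀ t ∈ Set.Icc 0 T,
      ∑ i ∈ Finset.Icc 1 n with J ≤ i, (i : ℝ) * u t i ≤ ε := by
  have hM := massNorm_nonneg c₀
  have h1 := (tendsto_tailBound hc₀.1).const_mul (2 * Real.exp (16 * massNorm c₀ * T))
  rw [mul_zero] at h1
  obtain ⟨k, hk⟩ := (h1.eventually (gt_mem_nhds hε)).exists
  refine ⟨2 * 2 ^ k, fun n u hn hu t ht => ?_⟩
  have hnn := fun i hi => hu.nonneg hφ hc₀ hn i hi t ht.1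
  calc ∑ i ∈ Finset.Icc 1 n with 2 * 2 ^ k ≤ i, (i : ℝ) * u t i
      ≤ ∑ i ∈ Finset.Icc 1 n with 2 * 2 ^ k ≤ i, 2 * (((i - 2 ^ k : ℕ) : ℝ) * u t i) := by
        refine Finset.sum_le_sum fun i hi => ?_
        rw [Finset.mem_filter] at hi
        have h2 : i ≤ 2 * (i - 2 ^ k) := by omega
        have h3 : (i : ℝ) ≤ 2 * ((i - 2 ^ k : ℕ) : ℝ) := by exact_mod_cast h2
        rw [← mul_assoc]
        exact mul_le_mul_of_nonneg_right h3 (hnn i hi.1)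
    _ ≤ ∑ i ∈ Finset.Icc 1 n, 2 * (((i - 2 ^ k : ℕ) : ℝ) * u t i) :=
        Finset.sum_le_sum_of_subset_of_nonneg (Finset.filter_subset _ _) fun i hi _ => by
          have := hnn i hi
          positivity
    _ = 2 * ∑ i ∈ Finset.Icc 1 n, ((i - 2 ^ k : ℕ) : ℝ) * u t i := by rw [Finset.mul_sum]
    _ ≤ 2 * (tailBound c₀ k * Real.exp (16 * massNorm c₀ * T)) := by
        have h4 := hu.tail_le hφ hb hc₀ hn k t ht.1
        have h5 : Real.exp (16 * massNorm c₀ * t) ≤ Real.exp (16 * massNorm c₀ * T) :=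
          Real.exp_le_exp.2 (mul_le_mul_of_nonneg_left ht.2 (by positivity))
        have h6 := mul_le_mul_of_nonneg_left h5 (tailBound_nonneg c₀ k)
        linarith
    _ ≤ ε := by linarith

/-! ### Global solutions of the truncated system -/

/-- An autonomous ODE whose vector field is bounded and globally Lipschitz has a solution on
`[0, ∞)`: boundedness makes Picard–Lindelöf applicable on every interval `[0, N]`, and uniqueness
glues these solutions. -/
theorem exists_hasDerivWithinAt_Ici_of_bounded_lipschitz {E : Type*} [NormedAddCommGroup E]
    [NormedSpace ℝ E] [CompleteSpace E] {F : E → E} {K L : NNReal} (hF : LipschitzWith K F)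
    (hL : ∀ x, ‖F x‖ ≤ L) (x₀ : E) :
    ∃ α : ℝ → E, α 0 = x₀ ∧
      ∀ t, 0 ≤ t → HasDerivWithinAt α (F (α t)) (Set.Ici 0) t := by
  have hex : ∀ N : ℕ, ∃ α : ℝ → E, α 0 = x₀ ∧
      ∀ t ∈ Set.Icc (0 : ℝ) N, HasDerivWithinAt α (F (α t)) (Set.Icc (0 : ℝ) N) t := by
    intro N
    have hp : IsPicardLindelof (fun _ => F) (⟨0, le_rfl, N.cast_nonneg⟩ : Set.Icc (0 : ℝ) N) x₀
        (L * N) 0 L K :=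
      IsPicardLindelof.of_time_independent (fun x _ => hL x) hF.lipschitzOnWith (by simp)
    exact hp.exists_eq_forall_mem_Icc_hasDerivWithinAt₀
  choose α h0 hα using hex
  have hcont : ∀ N : ℕ, ContinuousOn (α N) (Set.Icc (0 : ℝ) N) := fun N t ht =>
    (hα N t ht).continuousWithinAt
  have hIci : ∀ N : ℕ, ∀ t : ℝ, 0 ≤ t → t < N → Set.Icc (0 : ℝ) N ∈ 𝓝[Set.Ici 0] t := by
    intro N t _ ht
    filter_upwards [self_mem_nhdsWithin, mem_nhdsWithin_of_mem_nhds (Iio_mem_nhds ht)]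
      with s hs hs'
    exact ⟨hs, le_of_lt hs'⟩
  have hd : ∀ N : ℕ, ∀ t : ℝ, 0 ≤ t → t < N → HasDerivWithinAt (α N) (F (α N t)) (Set.Ici 0) t :=
    fun N t h1 h2 => (hα N t ⟨h1, h2.le⟩).mono_of_mem_nhdsWithin (hIci N t h1 h2)
  have heq : ∀ N N' : ℕ, N ≤ N' → Set.EqOn (α N) (α N') (Set.Icc 0 N) := by
    intro N N' hle
    have hle' : (N : ℝ) ≤ N' := by exact_mod_cast hle
    refine ODE_solution_unique (v := fun _ => F) (K := K) (fun _ => hF) (hcont N) ?_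
      ((hcont N').mono (Set.Icc_subset_Icc_right hle')) ?_ ((h0 N).trans (h0 N').symm)
    · exact fun t ht => (hd N t ht.1 ht.2).mono (Set.Ici_subset_Ici.2 ht.1)
    · exact fun t ht => (hd N' t ht.1 (ht.2.trans_le hle')).mono (Set.Ici_subset_Ici.2 ht.1)
  have hglue : ∀ N : ℕ, ∀ t : ℝ, 0 ≤ t → t < N → α (⌊t⌋₊ + 1) t = α N t := by
    intro N t h1 h2
    refine heq _ N ?_ ⟨h1, ?_⟩
    · have := (Nat.floor_lt h1).2 h2
      omega
    · push_cast
      exact (Nat.lt_floor_add_one t).le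
  refine ⟨fun t => α (⌊t⌋₊ + 1) t, h0 _, fun t ht => ?_⟩
  have hlt : t < ((⌊t⌋₊ + 1 : ℕ) : ℝ) := by
    push_cast
    exact Nat.lt_floor_add_one t
  refine (hd _ t ht hlt).congr_of_eventuallyEq ?_ rfl
  filter_upwards [self_mem_nhdsWithin, mem_nhdsWithin_of_mem_nhds (Iio_mem_nhds hlt)] with s hs hs'
  exact hglue _ s hs hs'

/-- Extension by zero of a vector indexed by `1, …, n`. -/
noncomputable def extendZero (n : ℕ) (x : Finset.Icc 1 n → ℝ) (j : ℕ) : ℝ :=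
  if h : j ∈ Finset.Icc 1 n then x ⟨j, h⟩ else 0

theorem contDiff_extendZero (n j : ℕ) : ContDiff ℝ 1 fun x => extendZero n x j := by
  unfold extendZero
  split_ifs with h
  · exact contDiff_apply ℝ ℝ (⟨j, h⟩ : Finset.Icc 1 n)
  · exact contDiff_const

theorem contDiff_truncRate_extendZero (φ : ℕ → ℕ → ℝ) (n i : ℕ) :
    ContDiff ℝ 1 fun x => truncRate φ n (extendZero n x) i := by
  have h := contDiff_extendZero n
  have hs : ∀ (s : Finset ℕ) (a : ℕ → ℝ),
      ContDiff ℝ 1 fun x => ∑ j ∈ s, a j * extendZero n x j := fun s a =>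
    ContDiff.sum fun j _ => contDiff_const.mul (h j)
  unfold truncRate
  split_ifs
  · exact (contDiff_const.mul ((h 1).pow 2)).sub ((h 1).mul (hs _ _))
  · exact (h _).mul (hs _ _)
  · exact (((h _).mul (hs _ _)).sub ((h i).mul (hs _ _))).sub ((h i).mul (hs _ _))

/-- Clamping of all coordinates to `[0, M]`. -/
noncomputable def clamp {ι : Type*} (M : ℝ) (x : ι → ℝ) (i : ι) : ℝ := max 0 (min M (x i))

theorem lipschitzWith_clamp {ι : Type*} [Fintype ι] (M : ℝ) :
    LipschitzWith 1 (clamp M : (ι → ℝ) → ι → ℝ) := by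
  refine LipschitzWith.of_dist_le_mul fun x y => ?_
  rw [NNReal.coe_one, one_mul, dist_pi_le_iff dist_nonneg]
  intro i
  have h := ((LipschitzWith.id (α := ℝ)).const_min M).const_max 0
  have h1 := h.dist_le_mul (x i) (y i)
  rw [NNReal.coe_one, one_mul] at h1
  exact h1.trans (dist_le_pi_dist x y i)

/-- The vector field is made bounded and Lipschitz by clamping its argument to the box
`[0, ‖c₀‖]^n`; nonnegativity and decay of the mass keep the solution inside the box, where clamping
has no effect. -/
theorem exists_isTruncatedSolution (hφ : IsCoagulationKernel φ) (hc₀ : c₀ ∈ BPlus) (hn : 2 ≤ n) :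
    ∃ u : ℝ → ℕ → ℝ, IsTruncatedSolution φ c₀ n u := by
  set M := massNorm c₀
  have hM : 0 ≤ M := massNorm_nonneg c₀
  let V : (Finset.Icc 1 n → ℝ) → Finset.Icc 1 n → ℝ := fun x i => truncRate φ n (extendZero n x) i
  have hV : ContDiff ℝ 1 V := contDiff_pi.2 fun i => contDiff_truncRate_extendZero φ n i
  let box : Set (Finset.Icc 1 n → ℝ) := Set.univ.pi fun _ => Set.Icc 0 M
  have hbox : IsCompact box := isCompact_univ_pi fun _ => isCompact_Icc
  have hmaps : ∀ x, clamp M x ∈ box := fun x i _ =>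
    ⟨le_max_left _ _, max_le hM (min_le_left _ _)⟩
  obtain ⟨K, hK⟩ := hV.locallyLipschitz.locallyLipschitzOn.exists_lipschitzOnWith_of_compact hbox
  obtain ⟨L, hL⟩ := hbox.exists_bound_of_continuousOn hV.continuous.continuousOn
  have hlip : LipschitzWith (K * 1) (V ∘ clamp M) := by
    rw [← lipschitzOnWith_univ]
    exact hK.comp (lipschitzWith_clamp M).lipschitzOnWith fun x _ => hmaps x
  obtain ⟨α, hα0, hα⟩ := exists_hasDerivWithinAt_Ici_of_bounded_lipschitz (L := L.toNNReal) hlip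
    (fun x => (hL _ (hmaps x)).trans (Real.le_coe_toNNReal L)) fun i => c₀ i
  have hα' : ∀ i : Finset.Icc 1 n, ∀ t, 0 ≤ t → HasDerivWithinAt (fun s => α s i)
      (truncRate φ n (extendZero n (clamp M (α t))) i) (Set.Ici 0) t := fun i t ht =>
    (hasDerivWithinAt_pi.1 (hα t ht)) i
  have hclamp : ∀ x j, 0 ≤ extendZero n (clamp M x) j := by
    intro x j
    unfold extendZero
    split_ifs
    · exact le_max_left _ _
    · exact le_rfl
  have hnn : ∀ i : Finset.Icc 1 n, ∀ t, 0 ≤ t → 0 ≤ α t i := by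
    intro i t ht
    have hi := Finset.mem_Icc.1 i.2
    refine nonneg_of_deriv_nonneg_of_neg (T := t) (hα' i) ?_ ?_ t ⟨ht, le_rfl⟩
    · rw [hα0]
      exact hc₀.2 _ hi.1
    · intro s _ hneg
      have hz : extendZero n (clamp M (α s)) i = 0 := by
        rw [extendZero, dif_pos i.2]
        exact max_eq_left ((min_le_right _ _).trans hneg.le)
      rw [truncRate_eq hn hi.1, growthFlux.eq_def _ _ (i : ℕ), truncLoss, hz]
      simp only [zero_mul, add_zero, ite_self, sub_zero]
      split_ifs with h2
      · exact growthFlux_nonneg hφ (by omega) fun j _ => hclamp _ j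
      · exact le_rfl
  have hext : ∀ t, ∀ i : Finset.Icc 1 n, extendZero n (α t) i = α t i := fun t i => by
    rw [extendZero, dif_pos i.2]
  have hmass : ∀ t, 0 ≤ t → ∑ i ∈ Finset.Icc 1 n, (i : ℝ) * extendZero n (α t) i ≤ M := by
    intro t ht
    refine le_of_hasDerivWithinAt_le (B := fun _ => M) (B' := fun _ => 0)
      (f := fun t => ∑ i ∈ Finset.Icc 1 n, (i : ℝ) * extendZero n (α t) i)
      (f' := fun t => ∑ i ∈ Finset.Icc 1 n,
        (i : ℝ) * truncRate φ n (extendZero n (clamp M (α t))) i)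
      (fun s hs => HasDerivWithinAt.fun_sum fun i hi => ?_) (fun s _ => hasDerivWithinAt_const _ _ _)
      ?_ (fun s hs => sum_mul_truncRate_nonpos hφ hn fun j _ => hclamp _ j) ht
    · have := hα' ⟨i, hi⟩ s hs
      simp only [← hext] at this
      exact this.const_mul _
    · refine le_trans (Finset.sum_congr rfl fun i hi => ?_).le (sum_le_massNorm hc₀ n)
      rw [hext 0 ⟨i, hi⟩, hα0]
  have hfix : ∀ t, 0 ≤ t → clamp M (α t) = α t := by
    intro t ht
    funext i
    have hi : (1 : ℝ) ≤ (i : ℕ) := by exact_mod_cast (Finset.mem_Icc.1 i.2).1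
    have h0 := hnn i t ht
    have h1 : ((i : ℕ) : ℝ) * extendZero n (α t) i ≤ M := by
      refine le_trans (Finset.single_le_sum (f := fun j : ℕ => (j : ℝ) * extendZero n (α t) j)
        (fun j hj => ?_) i.2) (hmass t ht)
      have := hnn ⟨j, hj⟩ t ht
      rw [← hext] at this
      exact mul_nonneg (Nat.cast_nonneg _) this
    rw [hext] at h1
    have h2 : α t i ≤ M := (le_mul_of_one_le_left h0 hi).trans h1
    rw [clamp, min_eq_right h2, max_eq_right h0]
  refine ⟨fun t => extendZero n (α t), fun i hi => ?_, fun i hi t ht => ?_⟩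
  · rw [hext 0 ⟨i, hi⟩, hα0]
  · have := hα' ⟨i, hi⟩ t ht
    rw [hfix t ht] at this
    simp only [← hext] at this
    exact this

/-! ### The rate on the nonnegative cone -/

theorem sum_range_le_massNorm (hz : z ∈ BPlus) (N : ℕ) :
    ∑ j ∈ Finset.range N, (j : ℝ) * z j ≤ massNorm z :=
  (Finset.sum_le_sum fun j _ => mul_le_mul_of_nonneg_left (le_abs_self (z j)) (Nat.cast_nonneg j)).trans
    (hz.1.sum_le_tsum _ fun i _ => by positivity)

theorem mul_le_massNorm (hz : z ∈ BPlus) (i : ℕ) : (i : ℝ) * z i ≤ massNorm z :=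
  (mul_le_mul_of_nonneg_left (le_abs_self (z i)) (Nat.cast_nonneg i)).trans
    (hz.1.le_tsum i fun i _ => by positivity)

theorem le_massNorm (hz : z ∈ BPlus) (hi : 1 ≤ i) : z i ≤ massNorm z := by
  refine le_trans ?_ (mul_le_massNorm hz i)
  exact le_mul_of_one_le_left (hz.2 i hi) (by exact_mod_cast hi)

theorem crush_term_nonneg (hφ : IsCoagulationKernel φ) (hz : ∀ j, 1 ≤ j → 0 ≤ z j)
    (hi : 1 ≤ i) (k : ℕ) : 0 ≤ φ i (i + k) * z (i + k) :=
  mul_nonneg (hφ i _ hi (by omega)).1 (hz _ (by omega))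

theorem crush_term_le (hb : KernelBound φ) (hz : ∀ j, 1 ≤ j → 0 ≤ z j) (hi : 1 ≤ i) (k : ℕ) :
    φ i (i + k) * z (i + k) ≤ 4 * (((i + k : ℕ) : ℝ) * z (i + k)) := by
  rw [← mul_assoc]
  refine mul_le_mul_of_nonneg_right ?_ (hz _ (by omega))
  refine (hb.le_two_mul hi (by omega)).trans ?_
  push_cast
  have : (0 : ℝ) ≤ k := Nat.cast_nonneg k
  linarith

theorem sum_crush_le (hb : KernelBound φ) (hz : z ∈ BPlus) (hi : 1 ≤ i) (N : ℕ) :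
    ∑ k ∈ Finset.range N, φ i (i + k) * z (i + k) ≤ 4 * massNorm z := by
  refine (Finset.sum_le_sum fun k _ => crush_term_le hb hz.2 hi k).trans ?_
  rw [← Finset.mul_sum]
  refine mul_le_mul_of_nonneg_left ?_ (by norm_num)
  refine le_trans ?_ (sum_range_le_massNorm hz (i + N))
  rw [Finset.sum_range_add]
  refine le_add_of_nonneg_left (Finset.sum_nonneg fun j _ => ?_)
  rcases Nat.eq_zero_or_pos j with rfl | hj
  · simp
  · exact mul_nonneg (Nat.cast_nonneg j) (hz.2 j hj)

theorem summable_crush (hφ : IsCoagulationKernel φ) (hb : KernelBound φ) (hz : z ∈ BPlus)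
    (hi : 1 ≤ i) : Summable fun k => φ i (i + k) * z (i + k) :=
  summable_of_sum_range_le (crush_term_nonneg hφ hz.2 hi) (sum_crush_le hb hz hi)

/-- Each of the three terms of the rate is at most `4 M²`. The bound does not depend on `i`, since
`i z_i ≤ M` compensates the growth of the kernel. -/
theorem abs_rate_le (hφ : IsCoagulationKernel φ) (hb : KernelBound φ) (hz : z ∈ BPlus)
    (hM : massNorm z ≤ M) (hi : 1 ≤ i) : |rate φ z i| ≤ 12 * M ^ 2 := by
  have hM0 : 0 ≤ M := (massNorm_nonneg z).trans hM
  have hG : ∀ i, 1 ≤ i → 0 ≤ growthFlux φ z i ∧ growthFlux φ z i ≤ 4 * M ^ 2 := by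
    intro i hi
    have hnn : ∀ j ∈ Finset.Icc 1 i, 0 ≤ z j := fun j hj => hz.2 j (Finset.mem_Icc.1 hj).1
    refine ⟨growthFlux_nonneg hφ hi hnn,
      (growthFlux_le hb hi hnn ((sum_le_massNorm hz i).trans hM)).trans ?_⟩
    have := mul_le_mul_of_nonneg_left ((mul_le_massNorm hz i).trans hM)
      (by positivity : (0 : ℝ) ≤ 4 * M)
    linarith
  have hL0 : 0 ≤ z i * ∑' k : ℕ, φ i (i + k) * z (i + k) :=
    mul_nonneg (hz.2 i hi) (tsum_nonneg (crush_term_nonneg hφ hz.2 hi))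
  have hL : z i * ∑' k : ℕ, φ i (i + k) * z (i + k) ≤ 4 * M ^ 2 := by
    have h1 : ∑' k : ℕ, φ i (i + k) * z (i + k) ≤ 4 * M :=
      (Real.tsum_le_of_sum_range_le (crush_term_nonneg hφ hz.2 hi) (sum_crush_le hb hz hi)).trans
        (mul_le_mul_of_nonneg_left hM (by norm_num))
    calc _ ≤ M * (4 * M) := mul_le_mul ((le_massNorm hz hi).trans hM) h1
          (tsum_nonneg (crush_term_nonneg hφ hz.2 hi)) hM0
      _ = _ := by ring
  have h1 := hG i hi
  have hr : rate φ z i = (if 2 ≤ i then growthFlux φ z (i - 1) else 0) - growthFlux φ z i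
    - z i * ∑' k : ℕ, φ i (i + k) * z (i + k) := rfl
  have h2 : 0 ≤ (if 2 ≤ i then growthFlux φ z (i - 1) else 0) ∧
      (if 2 ≤ i then growthFlux φ z (i - 1) else 0) ≤ 4 * M ^ 2 := by
    split_ifs
    · exact hG (i - 1) (by omega)
    · exact ⟨le_rfl, by positivity⟩
  rw [hr, abs_le]
  constructor <;> nlinarith [h1.1, h1.2, h2.1, h2.2, sq_nonneg M]

/-! ### Passing to the limit in infinite sums -/

/-- Pointwise convergence of nonnegative summable sequences with uniformly small tails implies
convergence of the sums. -/
theorem tendsto_tsum_of_uniform_tail {f : ℕ → ℕ → ℝ} {g : ℕ → ℝ} (hf0 : ∀ k j, 0 ≤ f k j)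
    (hf : ∀ k, Summable (f k)) (hg : Summable g) (hlim : ∀ j, Tendsto (fun k => f k j) atTop (𝓝 (g j)))
    (htail : ∀ ε > 0, ∃ J : ℕ, ∀ k N, ∑ j ∈ Finset.range N, f k (j + J) ≤ ε) :
    Tendsto (fun k => ∑' j, f k j) atTop (𝓝 (∑' j, g j)) := by
  have hg0 : ∀ j, 0 ≤ g j := fun j => ge_of_tendsto' (hlim j) fun k => hf0 k j
  rw [Metric.tendsto_atTop]
  intro ε hε
  obtain ⟨J, hJ⟩ := htail (ε / 4) (by linarith)
  have hgJ : ∀ N, ∑ j ∈ Finset.range N, g (j + J) ≤ ε / 4 := fun N =>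
    le_of_tendsto' (tendsto_finsetSum _ fun j _ => hlim (j + J)) fun k => hJ k N
  have hhead : Tendsto (fun k => ∑ j ∈ Finset.range J, f k j) atTop
      (𝓝 (∑ j ∈ Finset.range J, g j)) := tendsto_finsetSum _ fun j _ => hlim j
  obtain ⟨N, hN⟩ := Metric.tendsto_atTop.1 hhead (ε / 4) (by linarith)
  refine ⟨N, fun k hk => ?_⟩
  have h1 := hN k hk
  rw [Real.dist_eq, abs_lt] at h1 ⊢
  have h2 := Real.tsum_le_of_sum_range_le (fun j => hf0 k (j + J)) (hJ k)
  have h3 := Real.tsum_le_of_sum_range_le (fun j => hg0 (j + J)) hgJ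
  have h4 : 0 ≤ ∑' j, f k (j + J) := tsum_nonneg fun j => hf0 k (j + J)
  have h5 : 0 ≤ ∑' j, g (j + J) := tsum_nonneg fun j => hg0 (j + J)
  rw [← (hf k).sum_add_tsum_nat_add J, ← hg.sum_add_tsum_nat_add J]
  constructor <;> linarith

theorem mem_BPlus_of_tendsto {w : ℕ → ℕ → ℝ} (hw : ∀ k, w k ∈ BPlus) (hM : ∀ k, massNorm (w k) ≤ M)
    (hlim : ∀ i, Tendsto (fun k => w k i) atTop (𝓝 (z i))) : z ∈ BPlus ∧ massNorm z ≤ M := by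
  have hb : ∀ N, ∑ j ∈ Finset.range N, (j : ℝ) * |z j| ≤ M := fun N =>
    le_of_tendsto' (tendsto_finsetSum _ fun j _ => ((hlim j).abs.const_mul (j : ℝ))) fun k =>
      ((hw k).1.sum_le_tsum _ fun i _ => by positivity).trans (hM k)
  refine ⟨⟨summable_of_sum_range_le (fun _ => by positivity) hb, fun d hd => ?_⟩,
    Real.tsum_le_of_sum_range_le (fun _ => by positivity) hb⟩
  exact ge_of_tendsto' (hlim d) fun k => (hw k).2 d hd

/-- Continuity of the rate along sequences that converge pointwise with uniformly small tails of
the mass. -/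
theorem tendsto_rate (hφ : IsCoagulationKernel φ) (hb : KernelBound φ) {w : ℕ → ℕ → ℝ}
    (hw : ∀ k, w k ∈ BPlus) (hz : z ∈ BPlus) (hlim : ∀ i, Tendsto (fun k => w k i) atTop (𝓝 (z i)))
    (htail : ∀ ε > 0, ∃ J : ℕ, ∀ k N, ∑ j ∈ Finset.Ico J N, (j : ℝ) * w k j ≤ ε) (hi : 1 ≤ i) :
    Tendsto (fun k => rate φ (w k) i) atTop (𝓝 (rate φ z i)) := by
  have hG : ∀ i, Tendsto (fun k => growthFlux φ (w k) i) atTop (𝓝 (growthFlux φ z i)) := fun i =>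
    (hlim i).mul (tendsto_finsetSum _ fun j _ => (hlim j).const_mul _)
  have hL : Tendsto (fun k => ∑' l : ℕ, φ i (i + l) * w k (i + l)) atTop
      (𝓝 (∑' l : ℕ, φ i (i + l) * z (i + l))) := by
    refine tendsto_tsum_of_uniform_tail (fun k => crush_term_nonneg hφ (hw k).2 hi)
      (fun k => summable_crush hφ hb (hw k) hi) (summable_crush hφ hb hz hi)
      (fun l => (hlim _).const_mul _) fun ε hε => ?_
    obtain ⟨J, hJ⟩ := htail (ε / 4) (by linarith)
    refine ⟨J, fun k N => ?_⟩
    refine (Finset.sum_le_sum fun l _ => crush_term_le hb (hw k).2 hi (l + J)).trans ?_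
    rw [← Finset.mul_sum]
    have h1 : ∑ l ∈ Finset.range N, ((i + (l + J) : ℕ) : ℝ) * w k (i + (l + J)) =
        ∑ j ∈ Finset.Ico (i + J) (i + J + N), (j : ℝ) * w k j := by
      rw [Finset.sum_Ico_eq_sum_range, Nat.add_sub_cancel_left]
      refine Finset.sum_congr rfl fun l _ => ?_
      rw [show i + (l + J) = i + J + l by omega]
    have h2 : ∑ j ∈ Finset.Ico (i + J) (i + J + N), (j : ℝ) * w k j ≤
        ∑ j ∈ Finset.Ico J (i + J + N), (j : ℝ) * w k j := by
      refine Finset.sum_le_sum_of_subset_of_nonneg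
        (Finset.Ico_subset_Ico_left (by omega)) fun j _ _ => ?_
      rcases Nat.eq_zero_or_pos j with rfl | hj
      · simp
      · exact mul_nonneg (Nat.cast_nonneg j) ((hw k).2 j hj)
    rw [h1]
    linarith [hJ k (i + J + N)]
  have hr : ∀ z : ℕ → ℝ, rate φ z i = (if 2 ≤ i then growthFlux φ z (i - 1) else 0)
    - growthFlux φ z i - z i * ∑' k : ℕ, φ i (i + k) * z (i + k) := fun _ => rfl
  simp only [hr]
  refine Tendsto.sub (Tendsto.sub ?_ (hG i)) ((hlim i).mul hL)
  split_ifs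
  · exact hG _
  · exact tendsto_const_nhds

/-! ### Limits of approximate solutions -/

theorem timeInterval_top : timeInterval ⊤ = Set.Ici 0 := by
  ext t
  simp [timeInterval, EReal.coe_lt_top]

/-- A pointwise limit of approximate solutions with bounded mass and uniformly small tails is a
solution: the integral equations pass to the limit by dominated convergence. -/
theorem isSolution_of_tendsto (hφ : IsCoagulationKernel φ) (hb : KernelBound φ)
    {w : ℕ → ℝ → ℕ → ℝ} {c : ℝ → ℕ → ℝ} (hw : ∀ k t, 0 ≤ t → w k t ∈ BPlus)
    (hM : ∀ k t, 0 ≤ t → massNorm (w k t) ≤ M)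
    (hlim : ∀ i t, 0 ≤ t → Tendsto (fun k => w k t i) atTop (𝓝 (c t i)))
    (htail : ∀ T, ∀ ε > 0, ∃ J : ℕ, ∀ k, ∀ t ∈ Set.Icc 0 T, ∀ N,
      ∑ j ∈ Finset.Ico J N, (j : ℝ) * w k t j ≤ ε)
    (hinit : ∀ i, 1 ≤ i → ∀ᶠ k in atTop, w k 0 i = c₀ i)
    (hlip : ∀ i, 1 ≤ i → ∃ K : ℝ, ∀ᶠ k in atTop, ∀ s t, 0 ≤ s → 0 ≤ t →
      |w k t i - w k s i| ≤ K * |t - s|)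
    (hcont : ∀ i, 1 ≤ i → ∀ᶠ k in atTop, ContinuousOn (fun t => rate φ (w k t) i) (Set.Ici 0))
    (heq : ∀ i, 1 ≤ i → ∀ᶠ k in atTop, ∀ t, 0 ≤ t →
      w k t i = w k 0 i + ∫ h in (0 : ℝ)..t, rate φ (w k h) i) :
    IsSolution φ c₀ ⊤ c := by
  have hc : ∀ t, 0 ≤ t → c t ∈ BPlus ∧ massNorm (c t) ≤ M := fun t ht =>
    mem_BPlus_of_tendsto (fun k => hw k t ht) (fun k => hM k t ht) fun i => hlim i t ht
  have hrate : ∀ i, 1 ≤ i → ∀ t, 0 ≤ t →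
      Tendsto (fun k => rate φ (w k t) i) atTop (𝓝 (rate φ (c t) i)) := by
    intro i hi t ht
    refine tendsto_rate hφ hb (fun k => hw k t ht) (hc t ht).1 (fun i => hlim i t ht) ?_ hi
    intro ε hε
    obtain ⟨J, hJ⟩ := htail t ε hε
    exact ⟨J, fun k N => hJ k t ⟨ht, le_rfl⟩ N⟩
  have hmeas : ∀ i, 1 ≤ i → ∀ t, 0 ≤ t → ∀ᶠ k in atTop,
      AEStronglyMeasurable (fun h => rate φ (w k h) i) (volume.restrict (Set.uIoc 0 t)) := by
    intro i hi t ht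
    filter_upwards [hcont i hi] with k hk
    rw [Set.uIoc_of_le ht]
    exact (hk.mono fun x hx => hx.1.le).aestronglyMeasurable measurableSet_Ioc
  have hae : ∀ t, 0 ≤ t → ∀ {p : ℝ → Prop}, (∀ s, 0 ≤ s → p s) →
      ∀ᵐ s ∂volume, s ∈ Set.uIoc 0 t → p s := by
    intro t ht p hp
    refine Eventually.of_forall fun s hs => hp s ?_
    rw [Set.uIoc_of_le ht] at hs
    exact hs.1.le
  have hint : ∀ i, 1 ≤ i → ∀ t, 0 ≤ t →
      IntervalIntegrable (fun h => rate φ (c h) i) volume 0 t := by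
    intro i hi t ht
    refine (intervalIntegrable_const (c := 12 * M ^ 2)).mono_fun ?_ ?_
    · obtain ⟨N, hN⟩ := eventually_atTop.1 (hmeas i hi t ht)
      refine aestronglyMeasurable_of_tendsto_ae (f := fun k h => rate φ (w (k + N) h) i) atTop
        (fun k => hN _ (by omega)) ?_
      rw [ae_restrict_iff' measurableSet_uIoc]
      exact hae t ht fun s hs => (hrate i hi s hs).comp (tendsto_add_atTop_nat N)
    · rw [EventuallyLE, ae_restrict_iff' measurableSet_uIoc]
      refine hae t ht fun s hs => ?_
      exact (abs_rate_le hφ hb (hc s hs).1 (hc s hs).2 hi).trans (le_abs_self _)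
  refine ⟨?_, ?_, ?_, ?_, ?_, ?_, ?_⟩
  all_goals try rw [timeInterval_top]
  · exact fun t ht => (hc t ht).1
  · intro i hi
    refine tendsto_nhds_unique ((hlim i 0 le_rfl).congr' ?_) tendsto_const_nhds
    exact hinit i hi
  · intro i hi
    obtain ⟨K, hK⟩ := hlip i hi
    refine LipschitzOnWith.continuousOn (K := K.toNNReal)
      (LipschitzOnWith.of_dist_le_mul fun t ht s hs => ?_)
    rw [Real.dist_eq, Real.dist_eq]
    refine le_trans ?_ (mul_le_mul_of_nonneg_right (Real.le_coe_toNNReal K) (abs_nonneg _))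
    exact le_of_tendsto ((hlim i t ht).sub (hlim i s hs)).abs (hK.mono fun k hk => hk s t hs ht)
  · refine ⟨M, ?_⟩
    rintro _ ⟨t, ht, rfl⟩
    exact (hc t ht).2
  · intro i hi t ht
    have hterm : ∀ h, 0 ≤ h → ∑' j : ℕ, ENNReal.ofReal (φ i (j + 1) * c h (j + 1)) ≤
        ENNReal.ofReal (2 * ((i : ℝ) + 1) * M) := by
      intro h hh
      refine ENNReal.tsum_le_of_sum_range_le fun N => ?_
      rw [← ENNReal.ofReal_sum_of_nonneg fun j _ =>
        mul_nonneg (hφ i (j + 1) hi (by omega)).1 ((hc h hh).1.2 _ (by omega))]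
      refine ENNReal.ofReal_le_ofReal ?_
      refine le_trans ?_ (mul_le_mul_of_nonneg_left
        ((sum_range_le_massNorm (hc h hh).1 (N + 1)).trans (hc h hh).2) (by positivity))
      rw [Finset.sum_range_succ', Nat.cast_zero, zero_mul, add_zero, Finset.mul_sum]
      refine Finset.sum_le_sum fun j _ => ?_
      rw [← mul_assoc]
      refine mul_le_mul_of_nonneg_right ?_ ((hc h hh).1.2 _ (by omega))
      refine (hb.le_two_mul hi (by omega)).trans ?_
      have h1 : (1 : ℝ) ≤ ((j + 1 : ℕ) : ℝ) := by exact_mod_cast Nat.le_add_left 1 j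
      have h2 : (0 : ℝ) ≤ i := Nat.cast_nonneg i
      nlinarith
    calc ∫⁻ h in Set.Icc 0 t, ∑' j : ℕ, ENNReal.ofReal (φ i (j + 1) * c h (j + 1))
        ≤ ∫⁻ _ in Set.Icc 0 t, ENNReal.ofReal (2 * ((i : ℝ) + 1) * M) :=
          setLIntegral_mono measurable_const fun h hh => hterm h hh.1
      _ < ⊤ := by
          rw [setLIntegral_const, Real.volume_Icc]
          exact ENNReal.mul_lt_top ENNReal.ofReal_lt_top ENNReal.ofReal_lt_top
  · exact hint
  · intro i hi t ht
    have h1 : Tendsto (fun k => ∫ h in (0 : ℝ)..t, rate φ (w k h) i) atTop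
        (𝓝 (∫ h in (0 : ℝ)..t, rate φ (c h) i)) := by
      refine intervalIntegral.tendsto_integral_filter_of_dominated_convergence
        (fun _ => 12 * M ^ 2) (hmeas i hi t ht) ?_ intervalIntegrable_const
        (hae t ht fun s hs => hrate i hi s hs)
      exact Eventually.of_forall fun k => hae t ht fun s hs =>
        abs_rate_le hφ hb (hw k s hs) (hM k s hs) hi
    refine tendsto_nhds_unique ((hlim i t ht).congr' ?_) ((hlim i 0 le_rfl).add h1)
    filter_upwards [heq i hi] with k hk
    exact hk t ht

/-! ### Compactness -/

/-- Extraction of a pointwise convergent subsequence from a bounded family that is equi-Lipschitz in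
time: a diagonal argument at rational times (`|q|` runs through the nonnegative rationals). -/
theorem exists_subseq_tendsto {w : ℕ → ℝ → ℕ → ℝ} (hb : ∀ k t i, 0 ≤ t → w k t i ∈ Set.Icc 0 M)
    (hlip : ∀ i, ∃ K : ℝ, ∀ᶠ k in atTop, ∀ s t, 0 ≤ s → 0 ≤ t →
      |w k t i - w k s i| ≤ K * |t - s|) :
    ∃ (ψ : ℕ → ℕ) (c : ℝ → ℕ → ℝ), StrictMono ψ ∧
      ∀ i t, 0 ≤ t → Tendsto (fun k => w (ψ k) t i) atTop (𝓝 (c t i)) := by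
  have hcpt : IsCompact (Set.univ.pi fun _ : ℕ × ℚ => Set.Icc (0 : ℝ) M) :=
    isCompact_univ_pi fun _ => isCompact_Icc
  obtain ⟨a, -, ψ, hψ, ha⟩ := hcpt.tendsto_subseq
    (x := fun k (p : ℕ × ℚ) => w k |(p.2 : ℝ)| p.1) fun k p _ => hb k _ _ (abs_nonneg _)
  rw [tendsto_pi_nhds] at ha
  have hex : ∀ t i, ∃ l, 0 ≤ t → Tendsto (fun k => w (ψ k) t i) atTop (𝓝 l) := by
    intro t i
    by_cases ht : 0 ≤ t
    swap
    · exact ⟨0, fun h => absurd h ht⟩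
    obtain ⟨K, hK⟩ := hlip i
    suffices CauchySeq fun k => w (ψ k) t i by
      obtain ⟨l, hl⟩ := cauchySeq_tendsto_of_complete this
      exact ⟨l, fun _ => hl⟩
    rw [Metric.cauchySeq_iff]
    intro ε hε
    have hK1 : 0 < |K| + 1 := by positivity
    obtain ⟨q, hq1, hq2⟩ := exists_rat_btwn
      (lt_add_of_pos_right t (by positivity : 0 < ε / (3 * (|K| + 1))))
    have hq0 : 0 ≤ (q : ℝ) := ht.trans hq1.le
    have hsmall : K * |(q : ℝ) - t| < ε / 3 := by
      have h1 : |(q : ℝ) - t| < ε / (3 * (|K| + 1)) := by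
        rw [abs_of_pos (by linarith)]
        linarith
      calc K * |(q : ℝ) - t| ≤ (|K| + 1) * |(q : ℝ) - t| :=
            mul_le_mul_of_nonneg_right (by linarith [le_abs_self K]) (abs_nonneg _)
        _ < (|K| + 1) * (ε / (3 * (|K| + 1))) := mul_lt_mul_of_pos_left h1 hK1
        _ = ε / 3 := by field_simp
    have hcs := (ha (i, q)).cauchySeq
    obtain ⟨N₁, hN₁⟩ := Metric.cauchySeq_iff.1 hcs (ε / 3) (by linarith)
    obtain ⟨N₂, hN₂⟩ := eventually_atTop.1 (hψ.tendsto_atTop.eventually hK)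
    refine ⟨max N₁ N₂, fun m hm l hl => ?_⟩
    have h1 := hN₁ m (le_of_max_le_left hm) l (le_of_max_le_left hl)
    have h2 := hN₂ m (le_of_max_le_right hm) t q ht hq0
    have h3 := hN₂ l (le_of_max_le_right hl) t q ht hq0
    simp only [Function.comp_apply, abs_of_nonneg hq0, Real.dist_eq] at h1
    rw [Real.dist_eq]
    have h2' := h2.trans_lt hsmall
    have h3' := h3.trans_lt hsmall
    rw [abs_lt] at h1 h2' h3' ⊢
    constructor <;> linarith
  choose c hc using hex
  exact ⟨ψ, c, hψ, fun i t ht => hc t i ht⟩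

/-! ### Truncated solutions as approximate solutions -/

/-- The sequence with the entries `z_1, …, z_n` of `z` and all other entries zero. -/
noncomputable def cutoff (n : ℕ) (z : ℕ → ℝ) (j : ℕ) : ℝ := if j ∈ Finset.Icc 1 n then z j else 0

theorem cutoff_of_mem (hi : i ∈ Finset.Icc 1 n) : cutoff n z i = z i := if_pos hi

theorem cutoff_nonneg (hz : ∀ j ∈ Finset.Icc 1 n, 0 ≤ z j) (j : ℕ) : 0 ≤ cutoff n z j := by
  unfold cutoff
  split_ifs with h
  · exact hz j h
  · exact le_rfl

theorem cutoff_mem_BPlus (hz : ∀ j ∈ Finset.Icc 1 n, 0 ≤ z j) : cutoff n z ∈ BPlus := by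
  refine ⟨summable_of_ne_finset_zero (s := Finset.Icc 1 n) fun j hj => ?_,
    fun j _ => cutoff_nonneg hz j⟩
  simp only [cutoff, hj, if_false, abs_zero, mul_zero]

theorem massNorm_cutoff (hz : ∀ j ∈ Finset.Icc 1 n, 0 ≤ z j) :
    massNorm (cutoff n z) = ∑ j ∈ Finset.Icc 1 n, (j : ℝ) * z j := by
  rw [massNorm, tsum_eq_sum (s := Finset.Icc 1 n)]
  · refine Finset.sum_congr rfl fun j hj => ?_
    rw [cutoff_of_mem hj, abs_of_nonneg (hz j hj)]
  · intro j hj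
    simp only [cutoff, hj, if_false, abs_zero, mul_zero]

/-- Below the top size `n`, the truncated equations are the untruncated ones for sequences
supported in `1, …, n`. -/
theorem truncRate_eq_rate_cutoff (hi : 1 ≤ i) (hin : i < n) :
    truncRate φ n z i = rate φ (cutoff n z) i := by
  have hz : ∀ j, 1 ≤ j → j ≤ n → cutoff n z j = z j := fun j h1 h2 =>
    cutoff_of_mem (Finset.mem_Icc.2 ⟨h1, h2⟩)
  have hG : ∀ i, 1 ≤ i → i ≤ n → growthFlux φ (cutoff n z) i = growthFlux φ z i := by
    intro i h1 h2
    rw [growthFlux, growthFlux, hz i h1 h2]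
    congr 1
    refine Finset.sum_congr rfl fun j hj => ?_
    rw [Finset.mem_Icc] at hj
    rw [hz j hj.1 (by omega)]
  have hL : ∑' k : ℕ, φ i (i + k) * cutoff n z (i + k) = ∑ j ∈ Finset.Icc i n, φ i j * z j := by
    rw [tsum_eq_sum (s := Finset.range (n + 1 - i))]
    · rw [show Finset.Icc i n = Finset.Ico i (n + 1) from rfl, Finset.sum_Ico_eq_sum_range]
      refine Finset.sum_congr rfl fun k hk => ?_
      rw [Finset.mem_range] at hk
      rw [hz _ (by omega) (by omega)]
    · intro k hk
      have : i + k ∉ Finset.Icc 1 n := by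
        rw [Finset.mem_range] at hk
        rw [Finset.mem_Icc]
        omega
      simp only [cutoff, this, if_false, mul_zero]
  have hr : rate φ (cutoff n z) i = (if 2 ≤ i then growthFlux φ (cutoff n z) (i - 1) else 0)
    - growthFlux φ (cutoff n z) i
    - cutoff n z i * ∑' k : ℕ, φ i (i + k) * cutoff n z (i + k) := rfl
  rw [hr, truncRate_eq (by omega) hi, hL, hG i hi hin.le, hz i hi hin.le, truncLoss,
    if_neg hin.ne]
  split_ifs with h
  · rw [hG (i - 1) (by omega) (by omega)]
    ring
  · ring

namespace IsTruncatedSolution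

variable {u : ℝ → ℕ → ℝ}

theorem hasDeriv_cutoff (hu : IsTruncatedSolution φ c₀ n u) (hi : 1 ≤ i) (hin : i < n) {t : ℝ}
    (ht : 0 ≤ t) :
    HasDerivWithinAt (fun s => cutoff n (u s) i) (rate φ (cutoff n (u t)) i) (Set.Ici 0) t := by
  have hmem : i ∈ Finset.Icc 1 n := Finset.mem_Icc.2 ⟨hi, hin.le⟩
  simp only [cutoff_of_mem hmem]
  rw [← truncRate_eq_rate_cutoff hi hin]
  exact hu.hasDeriv i hmem t ht

theorem continuousOn_rate_cutoff (hu : IsTruncatedSolution φ c₀ n u) (hi : 1 ≤ i) (hin : i < n) :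
    ContinuousOn (fun t => rate φ (cutoff n (u t)) i) (Set.Ici 0) := by
  simp only [← truncRate_eq_rate_cutoff hi hin, truncRate_eq (by omega : 2 ≤ n) hi,
    if_neg hin.ne, growthFlux, truncLoss]
  have hc : ∀ j, 1 ≤ j → j ≤ n → ContinuousOn (fun t => u t j) (Set.Ici 0) := fun j h1 h2 =>
    hu.continuousOn (Finset.mem_Icc.2 ⟨h1, h2⟩)
  have hs : ∀ (s : Finset ℕ) (a : ℕ → ℝ), s ⊆ Finset.Icc 1 n →
      ContinuousOn (fun t => ∑ j ∈ s, a j * u t j) (Set.Ici 0) := fun s a hs =>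
    continuousOn_finsetSum _ fun j hj => continuousOn_const.mul (hu.continuousOn (hs hj))
  refine ContinuousOn.sub ?_ (((hc i hi hin.le).mul (hs _ _ ?_)).add
    ((hc i hi hin.le).mul (hs _ _ ?_)))
  · split_ifs with h
    · exact (hc _ (by omega) (by omega)).mul (hs _ _ (Finset.Icc_subset_Icc_right (by omega)))
    · exact continuousOn_const
  · exact Finset.Icc_subset_Icc_right hin.le
  · exact Finset.Icc_subset_Icc_left hi

theorem cutoff_eq_add_integral (hu : IsTruncatedSolution φ c₀ n u) (hi : 1 ≤ i) (hin : i < n)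
    {t : ℝ} (ht : 0 ≤ t) :
    cutoff n (u t) i = cutoff n (u 0) i + ∫ h in (0 : ℝ)..t, rate φ (cutoff n (u h)) i := by
  have hd := fun s (hs : 0 ≤ s) => hu.hasDeriv_cutoff hi hin hs
  rw [intervalIntegral.integral_eq_sub_of_hasDeriv_right_of_le ht
    (f := fun s => cutoff n (u s) i)
    (fun s hs => (hd s hs.1).continuousWithinAt.mono Set.Icc_subset_Ici_self)
    (fun s hs => (hd s hs.1.le).mono fun x hx => hs.1.le.trans (le_of_lt hx))
    (ContinuousOn.intervalIntegrable_of_Icc ht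
      ((hu.continuousOn_rate_cutoff hi hin).mono Set.Icc_subset_Ici_self))]
  ring

theorem abs_cutoff_sub_le (hu : IsTruncatedSolution φ c₀ n u) (hφ : IsCoagulationKernel φ)
    (hb : KernelBound φ) (hc₀ : c₀ ∈ BPlus) (hi : 1 ≤ i) (hin : i < n) {s t : ℝ} (hs : 0 ≤ s)
    (ht : 0 ≤ t) :
    |cutoff n (u t) i - cutoff n (u s) i| ≤ 12 * massNorm c₀ ^ 2 * |t - s| := by
  have hn : 2 ≤ n := by omega
  refine (convex_Ici (0 : ℝ)).norm_image_sub_le_of_norm_hasDerivWithin_le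
    (f := fun s => cutoff n (u s) i) (fun x hx => hu.hasDeriv_cutoff hi hin hx) (fun x hx => ?_)
    hs ht
  have hnn : ∀ j ∈ Finset.Icc 1 n, 0 ≤ u x j := fun j hj => hu.nonneg hφ hc₀ hn j hj x hx
  refine abs_rate_le hφ hb (cutoff_mem_BPlus hnn) ?_ hi
  rw [massNorm_cutoff hnn]
  exact hu.mass_le hφ hc₀ hn hx

end IsTruncatedSolution

/-- Solutions of the truncated systems, extended by zero, satisfy the hypotheses of
`exists_subseq_tendsto` and `isSolution_of_tendsto`: at each fixed size `i` they solve the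
untruncated equation as soon as `i < n`. -/
theorem exists_subseq_isSolution (hφ : IsCoagulationKernel φ) (hb : KernelBound φ)
    (hc₀ : c₀ ∈ BPlus) {u : ℕ → ℝ → ℕ → ℝ}
    (hu : ∀ n, 2 ≤ n → IsTruncatedSolution φ c₀ n (u n)) :
    ∃ (σ : ℕ → ℕ) (c : ℝ → ℕ → ℝ), StrictMono σ ∧
      (∀ i, 1 ≤ i → ∀ t, 0 ≤ t → Tendsto (fun k => u (σ k) t i) atTop (𝓝 (c t i))) ∧
      IsSolution φ c₀ ⊤ c := by
  have hnn : ∀ n, 2 ≤ n → ∀ t, 0 ≤ t → ∀ j ∈ Finset.Icc 1 n, 0 ≤ u n t j := fun n hn t ht j hj =>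
    (hu n hn).nonneg hφ hc₀ hn j hj t ht
  have hB : ∀ n, 2 ≤ n → ∀ t, 0 ≤ t → cutoff n (u n t) ∈ BPlus := fun n hn t ht =>
    cutoff_mem_BPlus (hnn n hn t ht)
  have hM : ∀ n, 2 ≤ n → ∀ t, 0 ≤ t → massNorm (cutoff n (u n t)) ≤ massNorm c₀ := by
    intro n hn t ht
    rw [massNorm_cutoff (hnn n hn t ht)]
    exact (hu n hn).mass_le hφ hc₀ hn ht
  have hlip : ∀ i, 1 ≤ i → ∀ n, i < n → ∀ s t, 0 ≤ s → 0 ≤ t →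
      |cutoff n (u n t) i - cutoff n (u n s) i| ≤ 12 * massNorm c₀ ^ 2 * |t - s| :=
    fun i hi n hin s t hs ht => (hu n (by omega)).abs_cutoff_sub_le hφ hb hc₀ hi hin hs ht
  have hzero : ∀ n (z : ℕ → ℝ), cutoff n z 0 = 0 := fun n z => by simp [cutoff]
  -- The shift by `2` skips the sizes `n < 2`, for which `u n` is arbitrary.
  have hbox : ∀ k t i, 0 ≤ t →
      cutoff (k + 2) (u (k + 2) t) i ∈ Set.Icc 0 (massNorm c₀) := by
    intro k t i ht
    rcases Nat.eq_zero_or_pos i with rfl | hi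
    · rw [hzero]
      exact ⟨le_rfl, massNorm_nonneg c₀⟩
    · have hk := hB (k + 2) (by omega) t ht
      exact ⟨hk.2 i hi, (le_massNorm hk hi).trans (hM (k + 2) (by omega) t ht)⟩
  have hequi : ∀ i, ∃ K : ℝ, ∀ᶠ k in atTop, ∀ s t, 0 ≤ s → 0 ≤ t →
      |cutoff (k + 2) (u (k + 2) t) i - cutoff (k + 2) (u (k + 2) s) i| ≤ K * |t - s| := by
    intro i
    refine ⟨12 * massNorm c₀ ^ 2, ?_⟩
    rcases Nat.eq_zero_or_pos i with rfl | hi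
    · refine Eventually.of_forall fun k s t _ _ => ?_
      rw [hzero, hzero, sub_zero, abs_zero]
      positivity
    · filter_upwards [eventually_ge_atTop i] with k hk
      exact hlip i hi (k + 2) (by omega)
  obtain ⟨ψ, c, hψ, hlim⟩ := exists_subseq_tendsto
    (w := fun k t => cutoff (k + 2) (u (k + 2) t)) hbox hequi
  have hσ : ∀ k, 2 ≤ ψ k + 2 := fun k => by omega
  have hlt : ∀ i, ∀ᶠ k in atTop, i < ψ k + 2 := fun i => by
    filter_upwards [eventually_ge_atTop i] with k hk
    have := hψ.le_apply (x := k)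
    omega
  refine ⟨fun k => ψ k + 2, c, fun a b hab => Nat.add_lt_add_right (hψ hab) 2, ?_, ?_⟩
  · intro i hi t ht
    refine (hlim i t ht).congr' ?_
    filter_upwards [hlt i] with k hk
    exact cutoff_of_mem (Finset.mem_Icc.2 ⟨hi, hk.le⟩)
  · refine isSolution_of_tendsto hφ hb (fun k => hB _ (hσ k)) (fun k => hM _ (hσ k)) hlim
      ?_ ?_ (fun i hi => ⟨12 * massNorm c₀ ^ 2, ?_⟩) ?_ ?_
    · intro T ε hε
      obtain ⟨J, hJ⟩ := exists_forall_tail_le hφ hb hc₀ T hε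
      refine ⟨J, fun k t ht N => le_trans ?_ (hJ _ _ (hσ k) (hu _ (hσ k)) t ht)⟩
      have h1 : ∀ j : ℕ, (j : ℝ) * cutoff (ψ k + 2) (u (ψ k + 2) t) j =
          if j ∈ Finset.Icc 1 (ψ k + 2) then (j : ℝ) * u (ψ k + 2) t j else 0 := fun j => by
        rw [cutoff, mul_ite, mul_zero]
      simp only [h1]
      rw [← Finset.sum_filter]
      refine Finset.sum_le_sum_of_subset_of_nonneg (fun j hj => ?_) fun j hj _ => ?_
      · rw [Finset.mem_filter] at hj ⊢
        exact ⟨hj.2, (Finset.mem_Ico.1 hj.1).1⟩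
      · exact mul_nonneg (Nat.cast_nonneg j)
          (hnn _ (hσ k) t ht.1 j (Finset.mem_filter.1 hj).1)
    · intro i hi
      filter_upwards [hlt i] with k hk
      have hmem : i ∈ Finset.Icc 1 (ψ k + 2) := Finset.mem_Icc.2 ⟨hi, hk.le⟩
      rw [cutoff_of_mem hmem]
      exact (hu _ (hσ k)).initial i hmem
    · filter_upwards [hlt i] with k hk
      exact hlip i hi _ hk
    · intro i hi
      filter_upwards [hlt i] with k hk
      exact (hu _ (hσ k)).continuousOn_rate_cutoff hi hk
    · intro i hi
      filter_upwards [hlt i] with k hk t ht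
      exact (hu _ (hσ k)).cutoff_eq_add_integral hi hk ht

end SafronovDubovski

theorem theorem3p1 (φ : ℕ → ℕ → ℝ) (c₀ : ℕ → ℝ)
    (hφ : SafronovDubovski.IsCoagulationKernel φ)
    (hbound : SafronovDubovski.KernelBound φ)
    (hc₀ : c₀ ∈ SafronovDubovski.BPlus) :
    (∃ c : ℝ → ℕ → ℝ, SafronovDubovski.IsSolution φ c₀ ⊤ c) ∧
    (∀ n : ℕ, 2 ≤ n → ∃ u : ℝ → ℕ → ℝ, SafronovDubovski.IsTruncatedSolution φ c₀ n u) ∧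
    (∀ u : ℕ → ℝ → ℕ → ℝ,
      (∀ n : ℕ, 2 ≤ n → SafronovDubovski.IsTruncatedSolution φ c₀ n (u n)) →
      ∃ (σ : ℕ → ℕ) (c : ℝ → ℕ → ℝ), StrictMono σ ∧
        (∀ i : ℕ, 1 ≤ i → ∀ t : ℝ, 0 ≤ t →
          Tendsto (fun k => u (σ k) t i) atTop (𝓝 (c t i))) ∧
        SafronovDubovski.IsSolution φ c₀ ⊤ c) := by
  have hex : ∀ n : ℕ, 2 ≤ n → ∃ u : ℝ → ℕ → ℝ, SafronovDubovski.IsTruncatedSolution φ c₀ n u :=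
    fun n hn => SafronovDubovski.exists_isTruncatedSolution hφ hc₀ hn
  refine ⟨?_, hex, fun u hu => SafronovDubovski.exists_subseq_isSolution hφ hbound hc₀ hu⟩
  choose! u hu using hex
  obtain ⟨-, c, -, -, hc⟩ := SafronovDubovski.exists_subseq_isSolution hφ hbound hc₀ hu
  exact ⟨c, hc⟩
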